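/- Let $|\psi\rangle^{RAB}\in\mathbb{C}^2\otimes\mathbb{C}^2\otimes\mathbb{C}^2$ be a three-qubit pure state (a unit vector) whose reduced state on $R$ is $\psi^R=\mathbb{1}/2$, and let $\lambda_0^B$ be the largest eigenvalue of its reduced state $\psi^B$ on $B$. For an integer $K\ge 1$ let $|\Phi_K^+\rangle=\frac{1}{\sqrt K}\sum_{l=0}^{K-1}|l\rangle\otimes|l\rangle$ be the maximally entangled state of Schmidt rank $K$. Non-catalytic exact state merging of $|\psi\rangle^{RAB}$ with resource $\Phi_K^+$ is said to be achievable if there is an LOCC map $\mathcal M$ of two parties, with inputs $A\overline A$ (sender) and $B\overline B$ (receiver) and with output $B'B$ at the receiver ($B'$ a copy of $A$; the sender's output is trivial), such that $$(\mathrm{id}^R\otimes\mathcal M)\bigl(\psi^{RAB}\otimes(\Phi_K^+)^{\overline A\,\overline B}\bigr)=\psi^{RB'B};$$ its entanglement cost is $\log_2K$. Here an LOCC map is a limit, as $r\to\infty$, of maps given by $r$ rounds of local measurements with finitely many outcomes, each round performed by one party and conditioned on all previous outcomes, followed by local operations of both parties conditioned on all outcomes; the measurements for $r+1$ rounds extend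 those for $r$ rounds. In particular all two-way finite-round protocols are included. Then: (1) for every integer $K\ge1$, non-catalytic exact state merging of $|\psi\rangle^{RAB}$ with resource $\Phi_K^+$ is achievable if and only if $\log_2K\ge\log_2\lceil 2\lambda_0^B\rceil$; (2) it is achievable at entanglement cost $\log_2K=0$ if and only if $\psi^B=\mathbb{1}/2$; (3) if $\psi^B\ne\mathbb{1}/2$, then the minimal achievable entanglement cost is $\log_2K=1$, that is, one ebit is necessary and sufficient. -/

import Mathlib

open scoped Kronecker

/-- A (finite-outcome) measurement given by measurement operators `M i`, possibly with different
input and output systems: `∑ i, (M i)† (M i) = 1`. -/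
def IsMeasurement {m n ι : Type*} [Fintype m] [Fintype n] [DecidableEq n] [Fintype ι]
    (M : ι → Matrix m n ℂ) : Prop :=
  ∑ i, (M i).conjTranspose * M i = 1

/-- The two parties, `A` (sender) and `B` (receiver). -/
inductive Party where
  | A : Party
  | B : Party

/-- A family of operators on `ℂ^a ⊗ ℂ^b` that is a measurement of party `A` (resp. `B`) on its own
system, tensored with the identity on the system of the other party. -/
def IsOneWayLocal {a b ι : Type*} [Fintype a] [DecidableEq a] [Fintype b] [DecidableEq b]
    [Fintype ι] (p : Party) (M : ι → Matrix (a × b) (a × b) ℂ) : Prop :=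
  match p with
  | Party.A => ∃ X : ι → Matrix a a ℂ, IsMeasurement X ∧ ∀ i, M i = X i ⊗ₖ (1 : Matrix b b ℂ)
  | Party.B => ∃ Y : ι → Matrix b b ℂ, IsMeasurement Y ∧ ∀ i, M i = (1 : Matrix a a ℂ) ⊗ₖ Y i

/-- A finite family of operators on `ℂ^a ⊗ ℂ^b`, labelled by the `n` possible outcomes. -/
structure OpFamily (a b : Type*) where
  n : ℕ
  op : Fin n → Matrix (a × b) (a × b) ℂ

/-- `G` is LOCC linked to `F`: after the outcome `m` of `F` has been broadcast, one party performs
a local measurement `M m` (that may depend on `m`) with outcome `k`, and the outcomes of `G` are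
the pairs `(m, k)`, with operators `M m k * F m`. -/
def LOCCLinked {a b : Type*} [Fintype a] [DecidableEq a] [Fintype b] [DecidableEq b]
    (F G : OpFamily a b) : Prop :=
  ∃ (p : Party) (N : ℕ) (e : Fin F.n × Fin N ≃ Fin G.n)
    (M : Fin F.n → Fin N → Matrix (a × b) (a × b) ℂ),
    (∀ m, IsOneWayLocal p (M m)) ∧ ∀ m k, G.op (e (m, k)) = M m k * F.op m

/-- `Φ` is the map obtained from the family `F` by letting, after the outcome `m` of `F`, each
party perform a local measurement conditioned by `m` (with output systems `a'`, `b'`), and then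
discarding all outcomes. -/
def IsCorrectedMap {a b a' b' : Type*} [Fintype a] [DecidableEq a] [Fintype b] [DecidableEq b]
    [Fintype a'] [Fintype b'] (F : OpFamily a b)
    (Φ : Matrix (a × b) (a × b) ℂ →ₗ[ℂ] Matrix (a' × b') (a' × b') ℂ) : Prop :=
  ∃ (s t : ℕ) (X : Fin F.n → Fin s → Matrix a' a ℂ) (Y : Fin F.n → Fin t → Matrix b' b ℂ),
    (∀ m, IsMeasurement (X m)) ∧ (∀ m, IsMeasurement (Y m)) ∧
    ∀ ρ, Φ ρ = ∑ m, ∑ i, ∑ j,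
      ((X m i ⊗ₖ Y m j) * F.op m) * ρ * ((X m i ⊗ₖ Y m j) * F.op m).conjTranspose

/-- LOCC maps between bipartite systems: limits, as the number of rounds tends to infinity, of
maps `Φ r`, where `Φ r` is given by the non-correcting `(r + 1)`-round family `F r` followed by
local operations conditioned by its outcome, each family `F (r + 1)` being LOCC linked to `F r`.
(Finite-round LOCC is contained in this: rounds may consist of the trivial measurement `{1}`.) -/
def IsLOCC {a b a' b' : Type*} [Fintype a] [DecidableEq a] [Fintype b] [DecidableEq b]
    [Fintype a'] [Fintype b']
    (M : Matrix (a × b) (a × b) ℂ →ₗ[ℂ] Matrix (a' × b') (a' × b') ℂ) : Prop :=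
  ∃ (F : ℕ → OpFamily a b)
    (Φ : ℕ → Matrix (a × b) (a × b) ℂ →ₗ[ℂ] Matrix (a' × b') (a' × b') ℂ),
    (∃ p, IsOneWayLocal p (F 0).op) ∧
    (∀ r, LOCCLinked (F r) (F (r + 1))) ∧
    (∀ r, IsCorrectedMap (F r) (Φ r)) ∧
    ∀ ρ, Filter.Tendsto (fun r => Φ r ρ) Filter.atTop (nhds (M ρ))

/-- The density operator `|v⟩⟨v|`. -/
def pureState {ι : Type*} (v : EuclideanSpace ℂ ι) : Matrix ι ι ℂ :=
  Matrix.vecMulVec v.ofLp (star v.ofLp)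

/-- `id^R ⊗ M`. -/
def idTensor (R : Type*) {m n : Type*} (M : Matrix m m ℂ →ₗ[ℂ] Matrix n n ℂ)
    (X : Matrix (R × m) (R × m) ℂ) : Matrix (R × n) (R × n) ℂ :=
  Matrix.of fun p q => M (Matrix.of fun i j => X (p.1, i) (q.1, j)) p.2 q.2

/-- The reduced state `ψ^R` of a pure state of `RAB`. -/
def reducedR {R A B : Type*} [Fintype A] [Fintype B] (ψ : EuclideanSpace ℂ (R × A × B)) :
    Matrix R R ℂ :=
  Matrix.of fun r r' => ∑ a, ∑ b, pureState ψ (r, a, b) (r', a, b)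

/-- The reduced state `ψ^B` of a pure state of `RAB`. -/
def reducedB {R A B : Type*} [Fintype R] [Fintype A] (ψ : EuclideanSpace ℂ (R × A × B)) :
    Matrix B B ℂ :=
  Matrix.of fun b b' => ∑ r, ∑ a, pureState ψ (r, a, b) (r, a, b')

/-- The maximally entangled state `(1/√K) ∑ l, |l⟩ ⊗ |l⟩`. -/
noncomputable def maxEntangled (K : ℕ) : EuclideanSpace ℂ (Fin K × Fin K) :=
  WithLp.toLp 2 fun x => if x.1 = x.2 then ((1 / Real.sqrt K : ℝ) : ℂ) else 0

/-- `|ψ⟩^{RAB} ⊗ |Φ_K⟩`, where `A` holds `A` and its half of `Φ_K`, and `B` holds `B` and its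
half of `Φ_K`. -/
noncomputable def mergingInput {R A B : Type*} (ψ : EuclideanSpace ℂ (R × A × B)) (K : ℕ) :
    EuclideanSpace ℂ (R × (A × Fin K) × (B × Fin K)) :=
  WithLp.toLp 2 fun x => ψ (x.1, x.2.1.1, x.2.2.1) * maxEntangled K (x.2.1.2, x.2.2.2)

/-- `|ψ⟩^{RB'B} ⊗ |Φ_L⟩`, where `A` holds only its half of `Φ_L`, and `B` holds `B'` (a copy of
the system `A`), `B` and its half of `Φ_L`. -/
noncomputable def mergingTarget {R A B : Type*} (ψ : EuclideanSpace ℂ (R × A × B)) (L : ℕ) :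
    EuclideanSpace ℂ (R × Fin L × ((A × B) × Fin L)) :=
  WithLp.toLp 2 fun x => ψ (x.1, x.2.2.1.1, x.2.2.1.2) * maxEntangled L (x.2.1, x.2.2.2)

/-- Exact state merging of `ψ`, consuming `Φ_K` and producing `Φ_L`, is achievable by LOCC of `A`
and `B`. -/
def ExactMergeable {R A B : Type*} [Fintype A] [DecidableEq A] [Fintype B] [DecidableEq B]
    (ψ : EuclideanSpace ℂ (R × A × B)) (K L : ℕ) : Prop :=
  ∃ M : Matrix ((A × Fin K) × (B × Fin K)) ((A × Fin K) × (B × Fin K)) ℂ →ₗ[ℂ]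
      Matrix (Fin L × ((A × B) × Fin L)) (Fin L × ((A × B) × Fin L)) ℂ,
    IsLOCC M ∧
    idTensor R M (pureState (mergingInput ψ K)) = pureState (mergingTarget ψ L)

/-- Exact state merging in the non-catalytic setting: `log₂ L = 0`. -/
def NonCatalyticMergeable {R A B : Type*} [Fintype A] [DecidableEq A] [Fintype B] [DecidableEq B]
    (ψ : EuclideanSpace ℂ (R × A × B)) (K : ℕ) : Prop :=
  ExactMergeable ψ K 1

/-- The set of entanglement costs `log₂ K`, in ebits, at which exact state merging of `ψ` in the
non-catalytic setting is achievable. -/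
noncomputable def nonCatalyticCosts {R A B : Type*} [Fintype A] [DecidableEq A] [Fintype B]
    [DecidableEq B] (ψ : EuclideanSpace ℂ (R × A × B)) : Set ℝ :=
  {c | ∃ K : ℕ, 1 ≤ K ∧ NonCatalyticMergeable ψ K ∧ c = Real.logb 2 K}

/-! ### Norm identities for operators and measurements -/

section SumsOfSquares

/-! For a qubit `B`, `⌈2λ₀⌉` is 1 when `ψ^B` is maximally mixed and 2 otherwise. Everything
therefore reduces to two facts: every `K ≥ 2` suffices, and `K = 1` suffices exactly when `ψ^B =
1/2`.

Converse (`reducedB_eq_of_mergeable_one`): an LOCC map is a limit of maps whose Kraus operators are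
products. Write `ψ` in Schmidt form across `RA : B`, with weights `λ₀ + λ₁ = 1`. A product Kraus
operator keeps each of the two terms a product across sender-plus-reference versus receiver. The
target is maximally entangled between `R` and the receiver, so it overlaps such a product by at most
`1/√2` times its norm. Summing over outcomes, with Cauchy–Schwarz for the cross terms, bounds the
fidelity by `(1 + 2√(λ₀λ₁))/2` (`sum_norm_overlap_sq_le`). The bound survives the limit, and
fidelity 1 forces `λ₀ = λ₁`.

Achievability (`nonCatalyticMergeable_of_rank_one`): if every outcome of a rank-one measurement by
the sender leaves `R` maximally mixed, then the receiver holds an isometric image of a purification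
of `R`, and a local operation turns it into the target. For `K ≥ 2` a Bell-type measurement
teleports `A`. For `K = 1`, let `M₀, M₁` be the `R × B` coefficient matrices of `ψ`. Since `ψ^R` and
`ψ^B` are both maximally mixed, `M₀M₁†` is normal. A normal `2 × 2` matrix has, after a suitable
phase, a scalar Hermitian part, and this phase defines a sender's basis of the required kind. -/

theorem ofReal_sum_norm_sq {k : Type*} [Fintype k] (y : k → ℂ) :
    ((∑ i, ‖y i‖ ^ 2 : ℝ) : ℂ) = dotProduct (star y) y := by
  simp [dotProduct, Complex.conj_mul']

/-- If `WᴴW = c`, then `W` scales the sum of the squared moduli of the coordinates by `c`. -/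
theorem sum_norm_sq_mulVec {m n : Type*} [Fintype m] [Fintype n] [DecidableEq n]
    {W : Matrix m n ℂ} {c : ℝ} (hW : W.conjTranspose * W = (c : ℂ) • (1 : Matrix n n ℂ))
    (x : n → ℂ) : ∑ i, ‖W.mulVec x i‖ ^ 2 = c * ∑ j, ‖x j‖ ^ 2 := by
  apply Complex.ofReal_injective
  rw [Complex.ofReal_mul, ofReal_sum_norm_sq, ofReal_sum_norm_sq, Matrix.star_mulVec, Matrix.dotProduct_mulVec,
    Matrix.vecMul_vecMul, hW, ← Matrix.dotProduct_mulVec]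
  simp [Matrix.smul_mulVec]

/-- A measurement preserves the total of the squared moduli. -/
theorem IsMeasurement.sum_norm_sq {m n ι : Type*} [Fintype m] [Fintype n] [DecidableEq n]
    [Fintype ι] {M : ι → Matrix m n ℂ} (hM : IsMeasurement M) (x : n → ℂ) :
    ∑ i, ∑ p, ‖(M i).mulVec x p‖ ^ 2 = ∑ j, ‖x j‖ ^ 2 := by
  -- Stacking the measurement operators on top of each other gives a single isometry.
  have h := sum_norm_sq_mulVec (W := Matrix.of fun (q : ι × m) j => M q.1 q.2 j) (c := 1) (by
    rw [Complex.ofReal_one, one_smul, ← (show _ = _ from hM)]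
    ext j k
    simp [Matrix.mul_apply, Matrix.sum_apply, Fintype.sum_prod_type]) x
  rw [one_mul, Fintype.sum_prod_type] at h
  rw [← h]
  rfl

theorem norm_sum_mul_sq_le {ι : Type*} [Fintype ι] (x y : ι → ℂ) :
    ‖∑ i, x i * y i‖ ^ 2 ≤ (∑ i, ‖x i‖ ^ 2) * ∑ i, ‖y i‖ ^ 2 := by
  refine le_trans ?_ (Finset.sum_mul_sq_le_sq_mul_sq _ _ _)
  gcongr
  exact (norm_sum_le _ _).trans (by simp)

end SumsOfSquares

/-! ### Products and compositions of measurements -/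

section Kronecker

theorem sum_kronecker_one {ι a b : Type*} [Fintype ι] [DecidableEq b] (X : ι → Matrix a a ℂ) :
    ∑ i, X i ⊗ₖ (1 : Matrix b b ℂ) = (∑ i, X i) ⊗ₖ (1 : Matrix b b ℂ) := by
  ext p q
  simp [Matrix.sum_apply, Matrix.kroneckerMap_apply, Finset.sum_mul]

theorem one_kronecker_sum {ι a b : Type*} [Fintype ι] [DecidableEq a] (Y : ι → Matrix b b ℂ) :
    ∑ i, (1 : Matrix a a ℂ) ⊗ₖ Y i = (1 : Matrix a a ℂ) ⊗ₖ ∑ i, Y i := by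
  ext p q
  simp [Matrix.sum_apply, Matrix.kroneckerMap_apply, Finset.mul_sum]

theorem kronecker_mulVec_prod {a b a' b' : Type*} [Fintype a] [Fintype b]
    (P : Matrix a' a ℂ) (Q : Matrix b' b ℂ) (x : a → ℂ) (y : b → ℂ) (p : a' × b') :
    (P ⊗ₖ Q).mulVec (fun q => x q.1 * y q.2) p = P.mulVec x p.1 * Q.mulVec y p.2 := by
  simp only [Matrix.mulVec, dotProduct, Matrix.kroneckerMap_apply, Fintype.sum_prod_type,
    Finset.sum_mul_sum]
  exact Finset.sum_congr rfl fun i _ => Finset.sum_congr rfl fun j _ => by ring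

theorem sum_norm_sq_prod {a b : Type*} [Fintype a] [Fintype b] (x : a → ℂ) (y : b → ℂ) :
    ∑ p : a × b, ‖x p.1 * y p.2‖ ^ 2 = (∑ i, ‖x i‖ ^ 2) * ∑ j, ‖y j‖ ^ 2 := by
  simp [Fintype.sum_prod_type, Finset.sum_mul_sum, mul_pow]

theorem IsMeasurement.kronecker {a b a' b' ι κ : Type*} [Fintype a] [DecidableEq a] [Fintype b]
    [DecidableEq b] [Fintype a'] [Fintype b'] [Fintype ι] [Fintype κ] {X : ι → Matrix a' a ℂ}
    {Y : κ → Matrix b' b ℂ} (hX : IsMeasurement X) (hY : IsMeasurement Y) :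
    IsMeasurement fun q : ι × κ => X q.1 ⊗ₖ Y q.2 := by
  unfold IsMeasurement at *
  simp only [Matrix.conjTranspose_kronecker, ← Matrix.mul_kronecker_mul, Fintype.sum_prod_type]
  rw [← Matrix.one_kronecker_one, ← hX, ← hY]
  ext p q
  simp only [Matrix.sum_apply, Matrix.kroneckerMap_apply, Finset.sum_mul_sum]

/-- Measuring first with `F` and then, depending on the outcome, with `M m`, is a measurement. -/
theorem IsMeasurement.comp {l m n ι κ : Type*} [Fintype l] [Fintype m] [DecidableEq m]
    [Fintype n] [DecidableEq n] [Fintype ι] [Fintype κ] {F : ι → Matrix m n ℂ}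
    {M : ι → κ → Matrix l m ℂ} (hF : IsMeasurement F) (hM : ∀ i, IsMeasurement (M i)) :
    IsMeasurement fun q : ι × κ => M q.1 q.2 * F q.1 := by
  unfold IsMeasurement at *
  rw [← hF, Fintype.sum_prod_type]
  refine Finset.sum_congr rfl fun i _ => ?_
  have : ∀ k, (M i k * F i).conjTranspose * (M i k * F i)
      = (F i).conjTranspose * ((M i k).conjTranspose * M i k) * F i := by
    intro k
    simp only [Matrix.conjTranspose_mul, Matrix.mul_assoc]
  simp only [this]
  rw [← Matrix.sum_mul, ← Matrix.mul_sum, hM i, Matrix.mul_one]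

end Kronecker

/-! ### LOCC maps as limits of separable maps; the fidelity bound -/

section Separable

variable {a b a' b' : Type*} [Fintype a] [DecidableEq a] [Fintype b] [DecidableEq b]
  [Fintype a'] [Fintype b']

/-- A measurement on a bipartite system all of whose operators are products. -/
def IsProductMeasurement {ι : Type*} [Fintype ι] (M : ι → Matrix (a' × b') (a × b) ℂ) : Prop :=
  IsMeasurement M ∧ ∀ i, ∃ (P : Matrix a' a ℂ) (Q : Matrix b' b ℂ), M i = P ⊗ₖ Q

theorem IsOneWayLocal.isProductMeasurement {ι : Type*} [Fintype ι] {p : Party}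
    {M : ι → Matrix (a × b) (a × b) ℂ} (h : IsOneWayLocal p M) : IsProductMeasurement M := by
  cases p with
  | A =>
    obtain ⟨X, hX, hM⟩ := h
    refine ⟨?_, fun i => ⟨_, _, hM i⟩⟩
    unfold IsMeasurement at *
    simp only [hM, Matrix.conjTranspose_kronecker, ← Matrix.mul_kronecker_mul,
      Matrix.conjTranspose_one, Matrix.one_mul]
    rw [sum_kronecker_one, hX, Matrix.one_kronecker_one]
  | B =>
    obtain ⟨Y, hY, hM⟩ := h
    refine ⟨?_, fun i => ⟨_, _, hM i⟩⟩
    unfold IsMeasurement at *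
    simp only [hM, Matrix.conjTranspose_kronecker, ← Matrix.mul_kronecker_mul,
      Matrix.conjTranspose_one, Matrix.one_mul]
    rw [one_kronecker_sum, hY, Matrix.one_kronecker_one]

theorem LOCCLinked.isProductMeasurement {F G : OpFamily a b} (h : LOCCLinked F G)
    (hF : IsProductMeasurement F.op) : IsProductMeasurement G.op := by
  obtain ⟨p, N, e, M, hM, hG⟩ := h
  refine ⟨?_, fun i => ?_⟩
  · have h := hF.1.comp fun m => (hM m).isProductMeasurement.1
    unfold IsMeasurement at *
    rw [← e.sum_comp, ← h]
    exact Finset.sum_congr rfl fun ⟨m, k⟩ _ => by rw [hG]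
  · obtain ⟨⟨m, k⟩, rfl⟩ := e.surjective i
    obtain ⟨P, Q, hPQ⟩ := (hM m).isProductMeasurement.2 k
    obtain ⟨P', Q', hPQ'⟩ := hF.2 m
    exact ⟨P * P', Q * Q', by rw [hG, hPQ, hPQ', Matrix.mul_kronecker_mul]⟩

/-- The Kraus operators of a corrected map form a product measurement. -/
theorem IsCorrectedMap.exists_kraus {F : OpFamily a b}
    {Φ : Matrix (a × b) (a × b) ℂ →ₗ[ℂ] Matrix (a' × b') (a' × b') ℂ} (h : IsCorrectedMap F Φ)
    (hF : IsProductMeasurement F.op) :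
    ∃ (ι : Type) (_ : Fintype ι) (M : ι → Matrix (a' × b') (a × b) ℂ),
      IsProductMeasurement M ∧ ∀ ρ, Φ ρ = ∑ i, M i * ρ * (M i).conjTranspose := by
  obtain ⟨s, t, X, Y, hX, hY, hΦ⟩ := h
  refine ⟨Fin F.n × Fin s × Fin t, inferInstance,
    fun q => (X q.1 q.2.1 ⊗ₖ Y q.1 q.2.2) * F.op q.1, ⟨?_, fun q => ?_⟩, fun ρ => ?_⟩
  · exact IsMeasurement.comp (M := fun m (q : Fin s × Fin t) => X m q.1 ⊗ₖ Y m q.2) hF.1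
      fun m => (hX m).kronecker (hY m)
  · obtain ⟨P, Q, hPQ⟩ := hF.2 q.1
    exact ⟨X q.1 q.2.1 * P, Y q.1 q.2.2 * Q, by simp only [hPQ, Matrix.mul_kronecker_mul]⟩
  · rw [hΦ]
    simp only [Fintype.sum_prod_type]

/-- Every LOCC map is a limit of maps with product Kraus operators. -/
theorem IsLOCC.exists_kraus
    {M : Matrix (a × b) (a × b) ℂ →ₗ[ℂ] Matrix (a' × b') (a' × b') ℂ} (h : IsLOCC M) :
    ∃ Φ : ℕ → Matrix (a × b) (a × b) ℂ →ₗ[ℂ] Matrix (a' × b') (a' × b') ℂ,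
      (∀ r, ∃ (ι : Type) (_ : Fintype ι) (K : ι → Matrix (a' × b') (a × b) ℂ),
        IsProductMeasurement K ∧ ∀ ρ, Φ r ρ = ∑ i, K i * ρ * (K i).conjTranspose) ∧
      ∀ ρ, Filter.Tendsto (fun r => Φ r ρ) Filter.atTop (nhds (M ρ)) := by
  obtain ⟨F, Φ, ⟨p, h0⟩, hlink, hcorr, hlim⟩ := h
  have hF : ∀ r, IsProductMeasurement (F r).op := by
    intro r
    induction r with
    | zero => exact h0.isProductMeasurement
    | succ r ih => exact (hlink r).isProductMeasurement ih
  exact ⟨Φ, fun r => (hcorr r).exists_kraus (hF r), hlim⟩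

/-- Overlap of a product vector with a vector `w` on `(R × a') × b'` that is maximally entangled
with respect to this cut, with Schmidt coefficients `√c`. -/
theorem norm_overlap_prod_sq_le {R : Type*} [Fintype R] [DecidableEq R] [DecidableEq a']
    {w : R → a' × b' → ℂ} {c : ℝ}
    (hw : ∀ r r' x x', ∑ y, star (w r (x, y)) * w r' (x', y)
      = if r = r' ∧ x = x' then (c : ℂ) else 0)
    (x : R → a' → ℂ) (y : b' → ℂ) :
    ‖∑ r, ∑ p : a' × b', star (w r p) * (x r p.1 * y p.2)‖ ^ 2
      ≤ c * (∑ r, ∑ i, ‖x r i‖ ^ 2) * ∑ j, ‖y j‖ ^ 2 := by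
  -- Maximal entanglement makes `W` equal to `√c` times an isometry, so the overlap is a pairing of
  -- `y` with `W x`, and Cauchy–Schwarz applies.
  set W : Matrix b' (R × a') ℂ := Matrix.of fun j q => star (w q.1 (q.2, j)) with hWdef
  have hW : W.conjTranspose * W = (c : ℂ) • (1 : Matrix (R × a') (R × a') ℂ) := by
    ext ⟨r, i⟩ ⟨r', i'⟩
    have := hw r' r i' i
    simp only [Matrix.mul_apply, Matrix.conjTranspose_apply, hWdef, Matrix.of_apply, star_star,
      Matrix.smul_apply, Matrix.one_apply, Prod.mk.injEq, smul_eq_mul, mul_ite, mul_one, mul_zero]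
    rw [show (∑ j, w r (i, j) * star (w r' (i', j))) = ∑ j, star (w r' (i', j)) * w r (i, j) from
      Finset.sum_congr rfl fun _ _ => mul_comm _ _, this]
    simp [eq_comm]
  have h := sum_norm_sq_mulVec hW fun q => x q.1 q.2
  rw [Fintype.sum_prod_type] at h
  rw [← h]
  refine le_trans (le_of_eq ?_) (norm_sum_mul_sq_le _ _)
  congr 2
  simp only [Matrix.mulVec, dotProduct, Finset.sum_mul, Fintype.sum_prod_type, hWdef,
    Matrix.of_apply]
  symm
  rw [Finset.sum_comm]
  refine Finset.sum_congr rfl fun r _ => ?_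
  rw [Finset.sum_comm]
  exact Finset.sum_congr rfl fun j _ => Finset.sum_congr rfl fun i _ => mul_assoc _ _ _

/-- Total overlap with a maximally entangled `w` after a product measurement of a vector
`∑ i, φ i ⊗ e i` with two terms. -/
theorem sum_norm_overlap_sq_le {R : Type*} [Fintype R] [DecidableEq R] [DecidableEq a']
    {ι : Type*} [Fintype ι] {K : ι → Matrix (a' × b') (a × b) ℂ} (hK : IsProductMeasurement K)
    {w : R → a' × b' → ℂ} {c : ℝ} (hc : 0 ≤ c)
    (hw : ∀ r r' x x', ∑ y, star (w r (x, y)) * w r' (x', y)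
      = if r = r' ∧ x = x' then (c : ℂ) else 0)
    (φ : Fin 2 → R → a → ℂ) (e : Fin 2 → b → ℂ) (he : ∀ i, ∑ j, ‖e i j‖ ^ 2 = 1)
    (d : Fin 2 → ℝ) (hd : ∀ i, ∑ r, ∑ j, ‖φ i r j‖ ^ 2 = d i) :
    ∑ k, ‖∑ r, ∑ p, star (w r p) * (K k).mulVec (fun q => ∑ i, φ i r q.1 * e i q.2) p‖ ^ 2
      ≤ c * (d 0 + d 1 + 2 * √(d 0 * d 1)) := by
  obtain ⟨hK, hprod⟩ := hK
  choose P Q hPQ using hprod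
  -- `u i k * v i k` is the norm of the `i`-th term after outcome `k`; its squares add up to `d i`
  -- because a measurement preserves the total norm.
  set u : Fin 2 → ι → ℝ := fun i k => √(∑ r, ∑ j, ‖(P k).mulVec (φ i r) j‖ ^ 2) with hu
  set v : Fin 2 → ι → ℝ := fun i k => √(∑ j, ‖(Q k).mulVec (e i) j‖ ^ 2) with hv
  have hu2 : ∀ i k, u i k ^ 2 = ∑ r, ∑ j, ‖(P k).mulVec (φ i r) j‖ ^ 2 := fun i k =>
    Real.sq_sqrt (by positivity)
  have hv2 : ∀ i k, v i k ^ 2 = ∑ j, ‖(Q k).mulVec (e i) j‖ ^ 2 := fun i k =>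
    Real.sq_sqrt (by positivity)
  have hg : ∀ i, ∑ k, (u i k * v i k) ^ 2 = d i := by
    intro i
    have h : ∀ k, (u i k * v i k) ^ 2
        = ∑ r, ∑ p, ‖(K k).mulVec (fun q => φ i r q.1 * e i q.2) p‖ ^ 2 := by
      intro k
      simp only [hPQ, kronecker_mulVec_prod, sum_norm_sq_prod]
      rw [mul_pow, hu2, hv2, Finset.sum_mul]
    simp only [h]
    rw [Finset.sum_comm, ← hd]
    refine Finset.sum_congr rfl fun r _ => ?_
    rw [hK.sum_norm_sq, sum_norm_sq_prod, he, mul_one]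
  have hsplit : ∀ k, ‖∑ r, ∑ p, star (w r p) *
      (K k).mulVec (fun q => ∑ i, φ i r q.1 * e i q.2) p‖ ^ 2
        ≤ c * (u 0 k * v 0 k + u 1 k * v 1 k) ^ 2 := by
    intro k
    have hb : ∀ i, ‖∑ r, ∑ p : a' × b', star (w r p) *
        ((P k).mulVec (φ i r) p.1 * (Q k).mulVec (e i) p.2)‖ ≤ √c * (u i k * v i k) := by
      intro i
      refine abs_le_of_sq_le_sq' ?_ (by positivity) |>.2
      rw [mul_pow, Real.sq_sqrt hc, mul_pow, hu2, hv2, ← mul_assoc]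
      exact norm_overlap_prod_sq_le hw _ _
    have hdecomp : ∑ r, ∑ p, star (w r p) *
        (K k).mulVec (fun q => ∑ i, φ i r q.1 * e i q.2) p
        = ∑ i : Fin 2, ∑ r, ∑ p : a' × b', star (w r p) *
          ((P k).mulVec (φ i r) p.1 * (Q k).mulVec (e i) p.2) := by
      symm
      rw [Finset.sum_comm]
      refine Finset.sum_congr rfl fun r _ => ?_
      rw [Finset.sum_comm]
      refine Finset.sum_congr rfl fun p _ => ?_
      rw [← Finset.mul_sum]
      congr 1
      simp only [← kronecker_mulVec_prod, ← hPQ]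
      simp only [Matrix.mulVec, dotProduct, Finset.mul_sum]
      exact Finset.sum_comm
    rw [hdecomp, Fin.sum_univ_two, ← Real.sq_sqrt hc, ← mul_pow, mul_add]
    gcongr
    exact (norm_add_le _ _).trans (add_le_add (hb 0) (hb 1))
  refine (Finset.sum_le_sum fun k _ => hsplit k).trans ?_
  rw [← Finset.mul_sum]
  gcongr
  -- Cauchy–Schwarz over the outcomes bounds the cross terms of the two Schmidt components.
  have hcs := Finset.sum_mul_sq_le_sq_mul_sq Finset.univ (fun k => u 0 k * v 0 k)
    fun k => u 1 k * v 1 k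
  rw [hg, hg] at hcs
  have hcs' := Real.le_sqrt_of_sq_le hcs
  have hexp : ∑ k, (u 0 k * v 0 k + u 1 k * v 1 k) ^ 2
      = d 0 + d 1 + 2 * ∑ k, u 0 k * v 0 k * (u 1 k * v 1 k) := by
    rw [← hg, ← hg, Finset.mul_sum, ← Finset.sum_add_distrib, ← Finset.sum_add_distrib]
    exact Finset.sum_congr rfl fun k _ => by ring
  rw [hexp]
  linarith

/-- The fidelity with `w` of the output of a map with Kraus operators `K`. -/
theorem fidelity_eq_sum_norm_sq {R m n ι : Type*} [Fintype R] [Fintype m] [Fintype n] [Fintype ι]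
    {Φ : Matrix m m ℂ →ₗ[ℂ] Matrix n n ℂ} {K : ι → Matrix n m ℂ}
    (hΦ : ∀ ρ, Φ ρ = ∑ i, K i * ρ * (K i).conjTranspose) (v : R → m → ℂ) (w : R → n → ℂ) :
    ∑ r, ∑ r', ∑ p, ∑ q, star (w r p) * Φ (Matrix.vecMulVec (v r) (star (v r'))) p q * w r' q
      = ((∑ k, ‖∑ r, ∑ p, star (w r p) * (K k).mulVec (v r) p‖ ^ 2 : ℝ) : ℂ) := by
  have h1 : ∀ r r' p q, star (w r p) * Φ (Matrix.vecMulVec (v r) (star (v r'))) p q * w r' q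
      = ∑ k, (star (w r p) * (K k).mulVec (v r) p) *
        star (star (w r' q) * (K k).mulVec (v r') q) := by
    intro r r' p q
    rw [hΦ, Matrix.sum_apply, Finset.mul_sum, Finset.sum_mul]
    refine Finset.sum_congr rfl fun k _ => ?_
    rw [Matrix.mul_vecMulVec, Matrix.vecMulVec_mul, ← Matrix.star_mulVec, Matrix.vecMulVec_apply]
    simp only [Pi.star_apply, star_mul', star_star]
    ring
  have h2 : ∀ k, ((‖∑ r, ∑ p, star (w r p) * (K k).mulVec (v r) p‖ ^ 2 : ℝ) : ℂ)
      = ∑ r, ∑ r', ∑ p, ∑ q, (star (w r p) * (K k).mulVec (v r) p) *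
        star (star (w r' q) * (K k).mulVec (v r') q) := by
    intro k
    rw [Complex.ofReal_pow, ← Complex.mul_conj', starRingEnd_apply, star_sum, Finset.sum_mul_sum]
    refine Finset.sum_congr rfl fun r _ => Finset.sum_congr rfl fun r' _ => ?_
    rw [star_sum, Finset.sum_mul_sum]
  simp only [h1, Complex.ofReal_sum, h2]
  symm
  rw [Finset.sum_comm]
  refine Finset.sum_congr rfl fun r _ => ?_
  rw [Finset.sum_comm]
  refine Finset.sum_congr rfl fun r' _ => ?_
  rw [Finset.sum_comm]
  refine Finset.sum_congr rfl fun p _ => ?_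
  exact Finset.sum_comm

end Separable

/-! ### Reduced states and their eigenvalues -/

section Reduced

variable {R A B : Type*} [Fintype R] [Fintype A]

theorem isHermitian_reducedB (ψ : EuclideanSpace ℂ (R × A × B)) : (reducedB ψ).IsHermitian := by
  ext b b'
  simp [reducedB, pureState, Matrix.vecMulVec_apply, mul_comm]

variable [Fintype B]

theorem trace_reducedB (ψ : EuclideanSpace ℂ (R × A × B)) :
    (reducedB ψ).trace = ((‖ψ‖ ^ 2 : ℝ) : ℂ) := by
  rw [EuclideanSpace.norm_sq_eq]
  simp only [Matrix.trace, Matrix.diag, reducedB, pureState, Matrix.of_apply,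
    Matrix.vecMulVec_apply, Fintype.sum_prod_type, Pi.star_apply, RCLike.star_def,
    Complex.mul_conj', Complex.ofReal_sum, Complex.ofReal_pow]
  rw [Finset.sum_comm]
  refine Finset.sum_congr rfl fun r _ => ?_
  rw [Finset.sum_comm]

/-- `⟨e|ψ^B|e⟩` is the squared norm of the component of `ψ` along `e`. -/
theorem star_dotProduct_reducedB_mulVec (ψ : EuclideanSpace ℂ (R × A × B)) (e : B → ℂ) :
    dotProduct (star e) ((reducedB ψ).mulVec e)
      = ((∑ r, ∑ a, ‖∑ b, ψ (r, a, b) * star (e b)‖ ^ 2 : ℝ) : ℂ) := by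
  have h : ∀ r a, ((‖∑ b, ψ (r, a, b) * star (e b)‖ ^ 2 : ℝ) : ℂ)
      = ∑ b, ∑ b', star (e b) * (ψ (r, a, b) * star (ψ (r, a, b')) * e b') := by
    intro r a
    rw [Complex.ofReal_pow, ← Complex.mul_conj', starRingEnd_apply, star_sum, Finset.sum_mul_sum]
    refine Finset.sum_congr rfl fun b _ => Finset.sum_congr rfl fun b' _ => ?_
    rw [star_mul', star_star]
    ring
  simp only [Complex.ofReal_sum, h]
  simp only [dotProduct, Matrix.mulVec, reducedB, pureState, Matrix.of_apply,
    Matrix.vecMulVec_apply, Pi.star_apply, Finset.sum_mul, Finset.mul_sum]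
  symm
  calc ∑ r, ∑ a, ∑ b, ∑ b', star (e b) * (ψ (r, a, b) * star (ψ (r, a, b')) * e b')
      = ∑ r, ∑ b, ∑ b', ∑ a, star (e b) * (ψ (r, a, b) * star (ψ (r, a, b')) * e b') :=
        Finset.sum_congr rfl fun r _ => by
          rw [Finset.sum_comm]
          exact Finset.sum_congr rfl fun b _ => Finset.sum_comm
    _ = _ := by
        rw [Finset.sum_comm]
        exact Finset.sum_congr rfl fun b _ => Finset.sum_comm

/-- Identifies the weights of the Schmidt decomposition across `RA : B`. -/
theorem eigenvalues_reducedB_eq [DecidableEq B] (ψ : EuclideanSpace ℂ (R × A × B)) (i : B) :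
    ∑ r, ∑ a, ‖∑ b, ψ (r, a, b) * star ((isHermitian_reducedB ψ).eigenvectorBasis i b)‖ ^ 2
      = (isHermitian_reducedB ψ).eigenvalues i := by
  apply Complex.ofReal_injective
  rw [← star_dotProduct_reducedB_mulVec, (isHermitian_reducedB ψ).mulVec_eigenvectorBasis]
  have h := (isHermitian_reducedB ψ).eigenvectorBasis.orthonormal.1 i
  have h2 : dotProduct (star ((isHermitian_reducedB ψ).eigenvectorBasis i).ofLp)
      ((isHermitian_reducedB ψ).eigenvectorBasis i).ofLp = 1 := by
    have := EuclideanSpace.norm_sq_eq ((isHermitian_reducedB ψ).eigenvectorBasis i)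
    rw [h] at this
    simp only [dotProduct, Pi.star_apply, RCLike.star_def, Complex.conj_mul']
    rw [one_pow] at this
    exact_mod_cast this.symm
  rw [dotProduct_smul, h2]
  simp

theorem Matrix.IsHermitian.eq_smul_one_of_eigenvalues [DecidableEq B] {ρ : Matrix B B ℂ}
    (h : ρ.IsHermitian) {c : ℝ} (hc : ∀ i, h.eigenvalues i = c) :
    ρ = (c : ℂ) • (1 : Matrix B B ℂ) := by
  have hs := h.spectral_theorem
  have : (Matrix.diagonal (RCLike.ofReal ∘ h.eigenvalues) : Matrix B B ℂ)
      = (c : ℂ) • (1 : Matrix B B ℂ) := by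
    ext i j
    by_cases hij : i = j <;> simp [Matrix.diagonal, hij, hc]
  rw [this] at hs
  rw [hs]
  simp

end Reduced

/-! ### Merging without entanglement forces a maximally mixed `ψ^B` -/

section Converse

variable {R A B : Type*} [DecidableEq R] [Fintype A]

/-- With `L = 1` the sender's output is trivial, so this is just `ψ^R` being scalar: the target is
maximally entangled between `R` and the receiver. -/
theorem sum_star_mergingTarget_one [Fintype B] {ψ : EuclideanSpace ℂ (R × A × B)} {c : ℝ}
    (hR : reducedR ψ = (c : ℂ) • (1 : Matrix R R ℂ)) (r r' : R) (x x' : Fin 1) :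
    ∑ y, star (mergingTarget ψ 1 (r, x, y)) * mergingTarget ψ 1 (r', x', y)
      = if r = r' ∧ x = x' then (c : ℂ) else 0 := by
  have h := congrFun (congrFun hR r') r
  simp only [reducedR, pureState, Matrix.of_apply, Matrix.vecMulVec_apply, Pi.star_apply,
    Matrix.smul_apply, Matrix.one_apply, smul_eq_mul, mul_ite, mul_one, mul_zero] at h
  simp only [mergingTarget, maxEntangled, Fintype.sum_prod_type, Subsingleton.elim x x']
  simp [mul_comm, eq_comm, Subsingleton.elim x' 0] at h ⊢
  exact h

/-- Non-catalytic merging without entanglement of a `ψ` with `ψ^R` maximally mixed is possible only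
if `ψ^B` is maximally mixed. -/
theorem reducedB_eq_of_mergeable_one [DecidableEq A] {ψ : EuclideanSpace ℂ (Fin 2 × A × Fin 2)} (hψ : ‖ψ‖ = 1)
    (hR : reducedR ψ = (1 / 2 : ℂ) • (1 : Matrix (Fin 2) (Fin 2) ℂ))
    (hM : NonCatalyticMergeable ψ 1) :
    reducedB ψ = (1 / 2 : ℂ) • (1 : Matrix (Fin 2) (Fin 2) ℂ) := by
  obtain ⟨M, hM, hmerge⟩ := hM
  obtain ⟨Φ, hΦ, hlim⟩ := hM.exists_kraus
  set h := isHermitian_reducedB ψ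
  have hR' : reducedR ψ = ((1 / 2 : ℝ) : ℂ) • (1 : Matrix (Fin 2) (Fin 2) ℂ) := by
    rw [hR]; norm_num
  set v : Fin 2 → (A × Fin 1) × (Fin 2 × Fin 1) → ℂ := fun r p => mergingInput ψ 1 (r, p) with hv
  set w : Fin 2 → Fin 1 × ((A × Fin 2) × Fin 1) → ℂ := fun r p => mergingTarget ψ 1 (r, p) with hw
  have htr : h.eigenvalues 0 + h.eigenvalues 1 = 1 := by
    have h1 := trace_reducedB ψ
    rw [h.trace_eq_sum_eigenvalues, hψ, Fin.sum_univ_two] at h1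
    norm_num at h1
    exact_mod_cast h1
  -- Schmidt decomposition across `RA : B`, from completeness of the eigenbasis of `ψ^B`.
  have hexp : ∀ r, v r = fun q => ∑ i, (∑ b, ψ (r, q.1.1, b) * star (h.eigenvectorBasis i b)) *
      h.eigenvectorBasis i q.2.1 := by
    intro r
    funext q
    have hU := Matrix.mem_unitaryGroup_iff.1 h.eigenvectorUnitary.2
    have hU' : ∀ b b', ∑ i, h.eigenvectorBasis i b * star (h.eigenvectorBasis i b')
        = if b = b' then 1 else 0 := by
      intro b b'
      have := congrFun (congrFun hU b) b'
      simpa [Matrix.mul_apply, Matrix.one_apply, Matrix.star_apply,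
        Matrix.IsHermitian.eigenvectorUnitary_apply] using this
    simp only [Finset.sum_mul]
    rw [Finset.sum_comm]
    have : ∀ b, ∑ i, ψ (r, q.1.1, b) * star (h.eigenvectorBasis i b) *
        h.eigenvectorBasis i q.2.1 = if q.2.1 = b then ψ (r, q.1.1, b) else 0 := by
      intro b
      rw [← mul_one (ψ (r, q.1.1, b)), ← mul_zero (ψ (r, q.1.1, b)), ← mul_ite, ← hU',
        Finset.mul_sum, mul_one]
      exact Finset.sum_congr rfl fun i _ => by ring
    simp only [this]
    simp [hv, mergingInput, maxEntangled, Subsingleton.elim q.1.2 q.2.2]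
  have hnorm : ∑ r, ∑ p, star (w r p) * w r p = 1 := by
    have hx : ∀ r, ∑ p, star (w r p) * w r p = 1 / 2 := by
      intro r
      rw [Fintype.sum_prod_type, Fin.sum_univ_one]
      exact (sum_star_mergingTarget_one hR' r r 0 0).trans (by norm_num)
    simp only [hx, Fin.sum_univ_two]
    norm_num
  have hMw : ∀ r r' p q, M (Matrix.vecMulVec (v r) (star (v r'))) p q = w r p * star (w r' q) := by
    intro r r' p q
    exact congrFun (congrFun hmerge (r, p)) (r', q)
  have hlimF : Filter.Tendsto (fun n => ∑ r, ∑ r', ∑ p, ∑ q,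
      star (w r p) * Φ n (Matrix.vecMulVec (v r) (star (v r'))) p q * w r' q)
      Filter.atTop (nhds 1) := by
    have h1 : ∑ r, ∑ r', ∑ p, ∑ q,
        star (w r p) * M (Matrix.vecMulVec (v r) (star (v r'))) p q * w r' q = 1 := by
      have h2 : ∀ r r' p q, star (w r p) * M (Matrix.vecMulVec (v r) (star (v r'))) p q * w r' q
          = (star (w r p) * w r p) * (star (w r' q) * w r' q) := by
        intro r r' p q
        rw [hMw]
        ring
      simp only [h2, ← Finset.mul_sum, ← Finset.sum_mul, hnorm, mul_one]
    rw [← h1]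
    refine tendsto_finsetSum _ fun r _ => tendsto_finsetSum _ fun r' _ =>
      tendsto_finsetSum _ fun p _ => tendsto_finsetSum _ fun q _ => ?_
    exact (((continuous_id.matrix_elem p q).tendsto _).comp (hlim _)).const_mul _ |>.mul_const _
  have hbound : ∀ n, (∑ r, ∑ r', ∑ p, ∑ q,
      star (w r p) * Φ n (Matrix.vecMulVec (v r) (star (v r'))) p q * w r' q).re
      ≤ 1 / 2 * (h.eigenvalues 0 + h.eigenvalues 1 +
        2 * √(h.eigenvalues 0 * h.eigenvalues 1)) := by
    intro n
    obtain ⟨ι, _, K, hK, hΦK⟩ := hΦ n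
    rw [fidelity_eq_sum_norm_sq hΦK, Complex.ofReal_re]
    simp only [hexp]
    have hc : (0 : ℝ) ≤ 1 / 2 := by norm_num
    have key := sum_norm_overlap_sq_le hK hc (w := w)
      (fun r r' x x' => sum_star_mergingTarget_one hR' r r' x x')
      (fun i r q => ∑ b, ψ (r, q.1, b) * star (h.eigenvectorBasis i b))
      (fun i q => h.eigenvectorBasis i q.1) (fun i => ?_) h.eigenvalues (fun i => ?_)
    · exact key
    · have h1 := EuclideanSpace.norm_sq_eq (h.eigenvectorBasis i)
      rw [h.eigenvectorBasis.orthonormal.1 i] at h1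
      simpa [Fintype.sum_prod_type] using h1.symm
    · rw [← eigenvalues_reducedB_eq]
      simp [Fintype.sum_prod_type]
  have hfin := le_of_tendsto ((Complex.continuous_re.tendsto _).comp hlimF)
    (Filter.Eventually.of_forall hbound)
  rw [Complex.one_re, htr] at hfin
  -- In the limit `1 ≤ (1 + 2√(λ₀λ₁))/2`. With sum 1 and product at least 1/4, the eigenvalues
  -- coincide.
  have hs : (1 / 2) ^ 2 ≤ h.eigenvalues 0 * h.eigenvalues 1 :=
    (Real.le_sqrt' (by norm_num)).1 (by linarith)
  have h0 : h.eigenvalues 0 = 1 / 2 := by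
    nlinarith [sq_nonneg (h.eigenvalues 0 - h.eigenvalues 1)]
  rw [h.eq_smul_one_of_eigenvalues (c := 1 / 2) (Fin.forall_fin_two.2 ⟨h0, by linarith⟩)]
  norm_num

end Converse

/-! ### One-way protocols as LOCC maps -/

section OneWay

/-- Rank-one operators `|x₀⟩⟨α k|` form a measurement if the vectors `α k` resolve the identity. -/
theorem isMeasurement_single_vecMulVec {a a' ι : Type*} [Fintype a] [DecidableEq a] [Fintype a']
    [DecidableEq a'] [Fintype ι] (x₀ : a') {α : ι → a → ℂ}
    (hα : ∀ x x', ∑ k, star (α k x) * α k x' = if x = x' then 1 else 0) :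
    IsMeasurement fun k => Matrix.vecMulVec (Pi.single x₀ 1 : a' → ℂ) (α k) := by
  unfold IsMeasurement
  ext x x'
  simp only [Matrix.sum_apply, Matrix.mul_apply, Matrix.conjTranspose_apply,
    Matrix.vecMulVec_apply, Matrix.one_apply, ← hα]
  refine Finset.sum_congr rfl fun k _ => ?_
  rw [Finset.sum_eq_single x₀ (by intro y _ hy; simp [hy]) (by simp)]
  simp

variable {a b b' : Type*} [Fintype a] [DecidableEq a] [Fintype b] [DecidableEq b] [Fintype b']

/-- One-way LOCC: a rank-one measurement of `A` with outcome `k`, followed by a measurement `Y k`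
of `B`, where all outcomes are discarded. -/
theorem exists_isLOCC_of_rank_one {ι κ : Type*} [Fintype ι] [Fintype κ] (x₀ : a) {α : ι → a → ℂ}
    (hα : ∀ x x', ∑ k, star (α k x) * α k x' = if x = x' then 1 else 0)
    {Y : ι → κ → Matrix b' b ℂ} (hY : ∀ k, IsMeasurement (Y k)) :
    ∃ M : Matrix (a × b) (a × b) ℂ →ₗ[ℂ] Matrix (Fin 1 × b') (Fin 1 × b') ℂ, IsLOCC M ∧
      ∀ ρ, M ρ = ∑ k, ∑ j, (Matrix.of (fun _ : Fin 1 => α k) ⊗ₖ Y k j) * ρ *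
        (Matrix.of (fun _ : Fin 1 => α k) ⊗ₖ Y k j).conjTranspose := by
  let eι := Fintype.equivFin ι
  let eκ := Fintype.equivFin κ
  let ea := Fintype.equivFin a
  let M : Matrix (a × b) (a × b) ℂ →ₗ[ℂ] Matrix (Fin 1 × b') (Fin 1 × b') ℂ :=
    { toFun := fun ρ => ∑ k, ∑ j, (Matrix.of (fun _ : Fin 1 => α k) ⊗ₖ Y k j) * ρ *
        (Matrix.of (fun _ : Fin 1 => α k) ⊗ₖ Y k j).conjTranspose
      map_add' := fun ρ σ => by
        simp only [Matrix.mul_add, Matrix.add_mul, Finset.sum_add_distrib]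
      map_smul' := fun c ρ => by
        simp only [Matrix.mul_smul, Matrix.smul_mul, Finset.smul_sum, RingHom.id_apply] }
  -- The sender resets to the fixed basis vector `x₀` after measuring. The sequence of families is
  -- constant, its links being trivial one-outcome measurements.
  let F : OpFamily a b :=
    ⟨Fintype.card ι, fun k =>
      Matrix.vecMulVec (Pi.single x₀ 1 : a → ℂ) (α (eι.symm k)) ⊗ₖ (1 : Matrix b b ℂ)⟩
  refine ⟨M, ⟨fun _ => F, fun _ => M, ⟨Party.A, _, ?_, fun _ => rfl⟩, fun _ => ?_, fun _ => ?_,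
    fun _ => tendsto_const_nhds⟩, fun _ => rfl⟩
  · refine isMeasurement_single_vecMulVec x₀ fun x x' => ?_
    rw [← hα]
    exact eι.symm.sum_comp fun k => star (α k x) * α k x'
  · refine ⟨Party.A, 1, Equiv.prodUnique _ _, fun _ _ => 1, fun _ => ⟨fun _ => 1, ?_, fun _ => ?_⟩,
      fun _ _ => ?_⟩
    · simp [IsMeasurement]
    · rw [Matrix.one_kronecker_one]
    · rw [Matrix.one_mul]
      rfl
  · refine ⟨Fintype.card a, Fintype.card κ,
      fun _ i => Matrix.of fun _ x => if x = ea.symm i then 1 else 0,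
      fun k j => Y (eι.symm k) (eκ.symm j), fun _ => ?_, fun k => ?_, fun ρ => ?_⟩
    · unfold IsMeasurement
      rw [ea.symm.sum_comp fun y => (Matrix.of fun (_ : Fin 1) x => if x = y then (1 : ℂ) else
        0).conjTranspose * (Matrix.of fun (_ : Fin 1) x => if x = y then (1 : ℂ) else 0)]
      ext x x'
      simp [Matrix.sum_apply, Matrix.mul_apply, Matrix.one_apply, eq_comm]
    · unfold IsMeasurement
      rw [eκ.symm.sum_comp fun j => (Y (eι.symm k) j).conjTranspose * Y (eι.symm k) j]
      exact hY _
    · change ∑ k, ∑ j, (Matrix.of (fun _ : Fin 1 => α k) ⊗ₖ Y k j) * ρ *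
        (Matrix.of (fun _ : Fin 1 => α k) ⊗ₖ Y k j).conjTranspose = _
      rw [← eι.symm.sum_comp]
      refine Finset.sum_congr rfl fun k _ => ?_
      -- The sender's system is discarded by a basis measurement into `Fin 1`; after the reset only
      -- outcome `x₀` occurs.
      have hop : ∀ (i : a) (j : κ), (Matrix.of (fun (_ : Fin 1) x => if x = i then (1 : ℂ) else 0)
          ⊗ₖ Y (eι.symm k) j) * F.op k = if i = x₀ then
            Matrix.of (fun _ : Fin 1 => α (eι.symm k)) ⊗ₖ Y (eι.symm k) j else 0 := by
        intro i j
        have hF : F.op k = Matrix.vecMulVec (Pi.single x₀ 1 : a → ℂ) (α (eι.symm k)) ⊗ₖ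
          (1 : Matrix b b ℂ) := rfl
        rw [hF, ← Matrix.mul_kronecker_mul, Matrix.mul_one]
        split_ifs with hi
        · congr 1
          ext p q
          simp [Matrix.mul_apply, Matrix.vecMulVec_apply, hi]
        · rw [show Matrix.of (fun (_ : Fin 1) x => if x = i then (1 : ℂ) else 0) *
            Matrix.vecMulVec (Pi.single x₀ 1 : a → ℂ) (α (eι.symm k)) = 0 from ?_]
          · exact Matrix.zero_kronecker _
          · ext p q
            simp [Matrix.mul_apply, Matrix.vecMulVec_apply, Pi.single_apply, Ne.symm hi]
      rw [ea.symm.sum_comp fun i => ∑ j, ((Matrix.of (fun (_ : Fin 1) x => if x = i then (1 : ℂ)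
        else 0) ⊗ₖ Y (eι.symm k) (eκ.symm j)) * F.op k) * ρ * ((Matrix.of (fun (_ : Fin 1) x =>
          if x = i then (1 : ℂ) else 0) ⊗ₖ Y (eι.symm k) (eκ.symm j)) * F.op k).conjTranspose]
      simp only [hop]
      rw [Finset.sum_eq_single x₀ (by intro y _ hy; simp [hy]) (by simp)]
      simp only [if_true]
      rw [eκ.symm.sum_comp fun j => (Matrix.of (fun _ : Fin 1 => α (eι.symm k)) ⊗ₖ
        Y (eι.symm k) j) * ρ * (Matrix.of (fun _ : Fin 1 => α (eι.symm k)) ⊗ₖ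
        Y (eι.symm k) j).conjTranspose]

end OneWay

/-! ### The receiver's recovery operation -/

section PartialIsometry

open scoped ComplexOrder in
/-- If `TᴴT = p` and `WᴴW = c` with `c > 0`, then some measurement has one outcome that maps `T` to
a multiple of `W`, and its other outcomes do not occur on the range of `T`. -/
theorem exists_measurement_mul_eq {R y o : Type*} [Fintype R] [DecidableEq R] [Fintype y]
    [DecidableEq y] [Fintype o] [DecidableEq o] [Nonempty o] {T : Matrix y R ℂ}
    {W : Matrix o R ℂ} {p c : ℝ} (hp : 0 ≤ p) (hc : 0 < c)
    (hT : T.conjTranspose * T = (p : ℂ) • (1 : Matrix R R ℂ))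
    (hW : W.conjTranspose * W = (c : ℂ) • (1 : Matrix R R ℂ)) :
    ∃ Y : Option y → Matrix o y ℂ, IsMeasurement Y ∧ Y none * T = (√(p / c) : ℂ) • W ∧
      ∀ j, Y (some j) * T = 0 := by
  obtain ⟨o₀⟩ := ‹Nonempty o›
  -- The projection onto the range of `T`. If `p = 0`, then `T = 0` and the convention `0⁻¹ = 0`
  -- gives `P = 0`.
  set P : Matrix y y ℂ := ((p⁻¹ : ℝ) : ℂ) • (T * T.conjTranspose) with hP
  have hPT : P * T = T := by
    rw [hP, Matrix.smul_mul, Matrix.mul_assoc, hT, Matrix.mul_smul, Matrix.mul_one, smul_smul]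
    rcases hp.eq_or_lt with rfl | hp
    · have : T = 0 := by
        rw [← Matrix.conjTranspose_mul_self_eq_zero, hT]
        simp
      simp [this]
    · rw [← Complex.ofReal_mul, inv_mul_cancel₀ hp.ne', Complex.ofReal_one, one_smul]
  have hPP : P * P = P := by
    conv_lhs => rw [hP]
    rw [Matrix.mul_smul, ← Matrix.mul_assoc, hPT]
  have hPH : P.conjTranspose = P := by
    rw [hP, Matrix.conjTranspose_smul, Matrix.conjTranspose_mul, Matrix.conjTranspose_conjTranspose]
    simp
  -- Normalised so that `k W T†` is a partial isometry with initial projection `P`; the remaining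
  -- outcomes resolve `1 - P`.
  set k : ℝ := √(p / c) / p with hk
  have hk2 : k * k * c = p⁻¹ := by
    rcases hp.eq_or_lt with rfl | hp
    · simp [hk]
    · rw [hk, div_mul_div_comm, Real.mul_self_sqrt (by positivity)]
      field_simp
  have hkp : k * p = √(p / c) := by
    rcases hp.eq_or_lt with rfl | hp
    · simp [hk]
    · rw [hk]
      field_simp
  refine ⟨fun j => j.elim ((k : ℂ) • (W * T.conjTranspose)) fun j =>
    Matrix.vecMulVec (Pi.single o₀ 1 : o → ℂ) (Pi.single j 1 : y → ℂ) * (1 - P), ?_, ?_, fun j => ?_⟩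
  · unfold IsMeasurement
    rw [Fintype.sum_option]
    have h1 : ((k : ℂ) • (W * T.conjTranspose)).conjTranspose * ((k : ℂ) • (W * T.conjTranspose))
        = P := by
      rw [Matrix.conjTranspose_smul, Matrix.conjTranspose_mul, Matrix.conjTranspose_conjTranspose,
        Matrix.smul_mul, Matrix.mul_smul, smul_smul, Matrix.mul_assoc,
        ← Matrix.mul_assoc W.conjTranspose, hW, Matrix.smul_mul, Matrix.one_mul, Matrix.mul_smul,
        smul_smul, hP, ← hk2]
      simp
    have h2 : IsMeasurement fun j : y =>
        Matrix.vecMulVec (Pi.single o₀ 1 : o → ℂ) (Pi.single j 1 : y → ℂ) :=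
      isMeasurement_single_vecMulVec o₀ fun x x' => by
        simp [Pi.single_apply]
    simp only [Option.elim, Matrix.conjTranspose_mul, h1]
    have h3 : ∀ j : y, (1 - P).conjTranspose *
        (Matrix.vecMulVec (Pi.single o₀ 1 : o → ℂ) (Pi.single j 1 : y → ℂ)).conjTranspose *
        (Matrix.vecMulVec (Pi.single o₀ 1 : o → ℂ) (Pi.single j 1 : y → ℂ) * (1 - P))
        = (1 - P).conjTranspose * ((Matrix.vecMulVec (Pi.single o₀ 1 : o → ℂ)
          (Pi.single j 1 : y → ℂ)).conjTranspose *
          Matrix.vecMulVec (Pi.single o₀ 1 : o → ℂ) (Pi.single j 1 : y → ℂ)) * (1 - P) := by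
      intro j
      simp only [Matrix.mul_assoc]
    simp only [h3]
    rw [← Matrix.sum_mul, ← Matrix.mul_sum, h2, Matrix.mul_one, Matrix.conjTranspose_sub,
      Matrix.conjTranspose_one, hPH, Matrix.mul_sub, Matrix.sub_mul, Matrix.sub_mul, hPP]
    simp
  · change (k : ℂ) • (W * T.conjTranspose) * T = _
    rw [Matrix.smul_mul, Matrix.mul_assoc, hT, Matrix.mul_smul, Matrix.mul_one, smul_smul,
      ← Complex.ofReal_mul, hkp]
  · change Matrix.vecMulVec (Pi.single o₀ 1 : o → ℂ) (Pi.single j 1 : y → ℂ) * (1 - P) * T = 0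
    rw [Matrix.mul_assoc, Matrix.sub_mul, hPT, Matrix.one_mul, sub_self, Matrix.mul_zero]

end PartialIsometry

/-! ### From a suitable sender's measurement to merging -/

section Achievability

/-- If the sender has a rank-one measurement after each outcome of which the reference is still
maximally mixed, then the receiver can recover the state. -/
theorem nonCatalyticMergeable_of_rank_one {R A B : Type*} [Fintype R] [DecidableEq R] [Fintype A]
    [DecidableEq A] [Fintype B] [DecidableEq B] [Nonempty A] [Nonempty B] {ι : Type*} [Fintype ι]
    {ψ : EuclideanSpace ℂ (R × A × B)} {K : ℕ} (hK : 1 ≤ K) {c : ℝ} (hc : 0 < c)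
    (hR : reducedR ψ = (c : ℂ) • (1 : Matrix R R ℂ)) {α : ι → A × Fin K → ℂ}
    (hα : ∀ x x', ∑ k, star (α k x) * α k x' = if x = x' then 1 else 0) {p : ι → ℝ}
    (hp : ∀ k, 0 ≤ p k) (hpc : ∑ k, p k = c)
    (hN : ∀ k r r', ∑ y, star (∑ x, α k x * mergingInput ψ K (r, x, y)) *
      (∑ x, α k x * mergingInput ψ K (r', x, y)) = if r = r' then (p k : ℂ) else 0) :
    NonCatalyticMergeable ψ K := by
  have : NeZero K := ⟨by omega⟩
  set T : ι → Matrix (B × Fin K) R ℂ := fun k =>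
    Matrix.of fun y r => ∑ x, α k x * mergingInput ψ K (r, x, y) with hTdef
  set W : Matrix ((A × B) × Fin 1) R ℂ := Matrix.of fun y r => mergingTarget ψ 1 (r, 0, y) with hWd
  have hT : ∀ k, (T k).conjTranspose * T k = (p k : ℂ) • (1 : Matrix R R ℂ) := by
    intro k
    ext r r'
    simp [Matrix.mul_apply, hTdef, Matrix.one_apply, ← hN]
  have hW : W.conjTranspose * W = (c : ℂ) • (1 : Matrix R R ℂ) := by
    ext r r'
    simp only [Matrix.mul_apply, Matrix.conjTranspose_apply, hWd, Matrix.of_apply,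
      sum_star_mergingTarget_one hR]
    simp [Matrix.one_apply]
  choose Y hY hYn hYs using fun k => exists_measurement_mul_eq (hp k) hc (hT k) hW
  obtain ⟨x₀⟩ : Nonempty (A × Fin K) := inferInstance
  obtain ⟨M, hM, hMρ⟩ := exists_isLOCC_of_rank_one x₀ hα hY
  refine ⟨M, hM, ?_⟩
  have hvec : ∀ k j r, (Matrix.of (fun _ : Fin 1 => α k) ⊗ₖ Y k j).mulVec
      (fun q => mergingInput ψ K (r, q)) = fun q => (Y k j * T k) q.2 r := by
    intro k j r
    funext q
    simp only [Matrix.mulVec, dotProduct, Matrix.kroneckerMap_apply, Matrix.of_apply,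
      Matrix.mul_apply, hTdef, Finset.mul_sum]
    rw [Fintype.sum_prod_type, Finset.sum_comm]
    exact Finset.sum_congr rfl fun y _ => Finset.sum_congr rfl fun x _ => by ring
  ext ⟨r, q⟩ ⟨r', q'⟩
  change M (Matrix.vecMulVec (fun q => mergingInput ψ K (r, q))
    (star fun q => mergingInput ψ K (r', q))) q q' = mergingTarget ψ 1 (r, q) *
      star (mergingTarget ψ 1 (r', q'))
  -- Outcome `k` yields the target with probability `p k / c`, so the outcomes sum to exactly the
  -- target.
  have hterm : ∀ k, ∑ j, ((Matrix.of (fun _ : Fin 1 => α k) ⊗ₖ Y k j) *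
      (Matrix.vecMulVec (fun q => mergingInput ψ K (r, q))
        (star fun q => mergingInput ψ K (r', q))) *
        (Matrix.of (fun _ : Fin 1 => α k) ⊗ₖ Y k j).conjTranspose) q q'
      = ((p k / c : ℝ) : ℂ) *
        (mergingTarget ψ 1 (r, q) * star (mergingTarget ψ 1 (r', q'))) := by
    intro k
    simp only [Matrix.mul_vecMulVec, Matrix.vecMulVec_mul, ← Matrix.star_mulVec, hvec,
      Matrix.vecMulVec_apply, Pi.star_apply]
    rw [Fintype.sum_option]
    simp only [hYs, hYn, Matrix.zero_apply, zero_mul, Finset.sum_const_zero, add_zero,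
      Matrix.smul_apply, smul_eq_mul, hWd, Matrix.of_apply]
    have hs : ((p k / c : ℝ) : ℂ) = (√(p k / c) : ℂ) * (√(p k / c) : ℂ) := by
      rw [← Complex.ofReal_mul, Real.mul_self_sqrt (div_nonneg (hp k) hc.le)]
    have h0 : ∀ s (t : Fin 1 × ((A × B) × Fin 1)), mergingTarget ψ 1 (s, 0, t.2)
        = mergingTarget ψ 1 (s, t) := by
      rintro s ⟨t, t'⟩
      rw [Subsingleton.elim t 0]
    rw [h0, h0, hs]
    simp only [star_mul', RCLike.star_def, Complex.conj_ofReal]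
    ring
  rw [hMρ]
  simp only [Matrix.sum_apply, hterm]
  rw [← Finset.sum_mul, ← Complex.ofReal_sum, ← Finset.sum_div, hpc, div_self hc.ne',
    Complex.ofReal_one, one_mul]

end Achievability

/-! ### Teleportation with `K ≥ 2` -/

section WithEntanglement

/-- The measurement of teleportation: for `i` and a sign `s`, the vector
`(|0⟩|i⟩ ± |1⟩|i + 1⟩) / √2`. -/
noncomputable def cyclicBell {n : ℕ} (k : Fin (n + 2) × Fin 2) (x : Fin 2 × Fin (n + 2)) : ℂ :=
  (1 / √2 : ℝ) * if x.1 = 0 then (if x.2 = k.1 then 1 else 0)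
    else (if x.2 = k.1 + 1 then (-1) ^ (k.2 : ℕ) else 0)

theorem ofReal_one_div_sqrt_mul_self {x : ℝ} (hx : 0 ≤ x) :
    ((1 / √x : ℝ) : ℂ) * ((1 / √x : ℝ) : ℂ) = ((1 / x : ℝ) : ℂ) := by
  rw [← Complex.ofReal_mul, div_mul_div_comm, Real.mul_self_sqrt hx, one_mul]

/-- Summing over the sign cancels the terms between `|0⟩` and `|1⟩`; summing over the shift gives
the identity on the second factor. -/
theorem sum_star_cyclicBell {n : ℕ} (x x' : Fin 2 × Fin (n + 2)) :
    ∑ k, star (cyclicBell k x) * cyclicBell k x' = if x = x' then 1 else 0 := by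
  have h2 := ofReal_one_div_sqrt_mul_self (x := 2) (by norm_num)
  obtain ⟨a, l⟩ := x
  obtain ⟨a', l'⟩ := x'
  have hl : ∀ (j i : Fin (n + 2)), j = i + 1 ↔ j - 1 = i := fun j i => sub_eq_iff_eq_add.symm
  have hterm : ∀ A B : ℂ, star (((1 / √2 : ℝ) : ℂ) * A) *
      (((1 / √2 : ℝ) : ℂ) * B) = ((1 / 2 : ℝ) : ℂ) * (star A * B) := by
    intro A B
    rw [← h2, star_mul', RCLike.star_def, Complex.conj_ofReal]
    ring
  simp only [cyclicBell, hterm, Fintype.sum_prod_type, Fin.sum_univ_two]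
  fin_cases a <;> fin_cases a' <;> simp [hl, Finset.sum_add_distrib, apply_ite (starRingEnd ℂ)] <;>
    split_ifs <;> norm_num

/-- With a resource of Schmidt rank at least two, a qubit can be teleported. -/
theorem mergeable_of_two_le {R B : Type*} [Fintype R] [DecidableEq R] [Fintype B] [DecidableEq B]
    [Nonempty B] {ψ : EuclideanSpace ℂ (R × Fin 2 × B)} {c : ℝ} (hc : 0 < c)
    (hR : reducedR ψ = (c : ℂ) • (1 : Matrix R R ℂ)) {K : ℕ} (hK : 2 ≤ K) :
    NonCatalyticMergeable ψ K := by
  obtain ⟨n, rfl⟩ := Nat.exists_eq_add_of_le' hK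
  have hn : (0 : ℝ) < ((n + 2 : ℕ) : ℝ) := by positivity
  refine nonCatalyticMergeable_of_rank_one (by omega) hc hR sum_star_cyclicBell
    -- The factors come from the Bell vector, the resource and `ψ^R`; there are `2 (n + 2)` equally
    -- likely outcomes.
    (p := fun _ => 1 / 2 * (1 / ((n + 2 : ℕ) : ℝ)) * c) (fun _ => by positivity) ?_ ?_
  · rw [Finset.sum_const, nsmul_eq_mul, Finset.card_univ, Fintype.card_prod, Fintype.card_fin,
      Fintype.card_fin]
    push_cast at hn ⊢
    field_simp
  · rintro ⟨i, s⟩ r r'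
    -- At least two levels are needed here: the branches `A = 0` and `A = 1` then reach orthogonal
    -- states of the receiver.
    have hi : i ≠ i + 1 := by simp
    have hN : ∀ r b l, ∑ x, cyclicBell (i, s) x * mergingInput ψ (n + 2) (r, x, (b, l))
        = (((1 / √2 : ℝ) : ℂ) * ((1 / √((n + 2 : ℕ) : ℝ) : ℝ) : ℂ)) *
          ((if l = i then ψ (r, 0, b) else 0) +
            if l = i + 1 then (-1) ^ (s : ℕ) * ψ (r, 1, b) else 0) := by
      intro r b l
      simp only [cyclicBell, mergingInput, maxEntangled, Fintype.sum_prod_type, Fin.sum_univ_two,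
        mul_ite, mul_zero, Finset.sum_ite_eq', Finset.mem_univ, if_true]
      split_ifs <;> simp_all <;> ring
    have hrr := congrFun (congrFun hR r') r
    simp only [reducedR, pureState, Matrix.of_apply, Matrix.vecMulVec_apply, Pi.star_apply,
      Matrix.smul_apply, Matrix.one_apply, smul_eq_mul, mul_ite, mul_one, mul_zero,
      Fin.sum_univ_two] at hrr
    have h2 := ofReal_one_div_sqrt_mul_self (x := 2) (by norm_num)
    have hKK := ofReal_one_div_sqrt_mul_self hn.le
    have hs : ((-1 : ℂ) ^ (s : ℕ)) * (-1) ^ (s : ℕ) = 1 := by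
      rw [← mul_pow]; norm_num
    have hsum : ∀ b, ∑ l : Fin (n + 2), star ((if l = i then ψ (r, 0, b) else 0) +
            if l = i + 1 then (-1) ^ (s : ℕ) * ψ (r, 1, b) else 0) *
          ((if l = i then ψ (r', 0, b) else 0) +
            if l = i + 1 then (-1) ^ (s : ℕ) * ψ (r', 1, b) else 0)
        = ψ (r', 0, b) * star (ψ (r, 0, b)) + ψ (r', 1, b) * star (ψ (r, 1, b)) := by
      intro b
      have : ∀ l : Fin (n + 2), star ((if l = i then ψ (r, 0, b) else 0) +
            if l = i + 1 then (-1) ^ (s : ℕ) * ψ (r, 1, b) else 0) *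
          ((if l = i then ψ (r', 0, b) else 0) +
            if l = i + 1 then (-1) ^ (s : ℕ) * ψ (r', 1, b) else 0)
          = (if l = i then ψ (r', 0, b) * star (ψ (r, 0, b)) else 0) +
            if l = i + 1 then ψ (r', 1, b) * star (ψ (r, 1, b)) else 0 := by
        intro l
        by_cases h1 : l = i
        · subst h1
          simp [mul_comm]
        · by_cases h3 : l = i + 1
          · simp only [h3, if_true, hi.symm, if_false, zero_add, star_mul', star_pow, star_neg,
              star_one]
            linear_combination (ψ (r', 1, b) * star (ψ (r, 1, b))) * hs
          · simp [h1, h3]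
      rw [Finset.sum_congr rfl fun l _ => this l]
      simp [Finset.sum_add_distrib]
    rw [Fintype.sum_prod_type]
    simp only [hN]
    have hpull : ∀ X Y : ℂ, star ((((1 / √2 : ℝ) : ℂ) * ((1 / √((n + 2 : ℕ) : ℝ) : ℝ) : ℂ)) * X) *
        ((((1 / √2 : ℝ) : ℂ) * ((1 / √((n + 2 : ℕ) : ℝ) : ℝ) : ℂ)) * Y)
        = ((1 / 2 : ℝ) : ℂ) * ((1 / ((n + 2 : ℕ) : ℝ) : ℝ) : ℂ) * (star X * Y) := by
      intro X Y
      rw [← h2, ← hKK]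
      simp only [star_mul', RCLike.star_def, Complex.conj_ofReal]
      ring
    simp only [hpull, ← Finset.mul_sum, hsum]
    rw [Finset.sum_add_distrib, hrr]
    simp only [Complex.ofReal_mul, mul_ite, mul_zero, eq_comm]

end WithEntanglement

/-! ### Merging with `K = 1` when `ψ^B` is maximally mixed -/

section WithoutEntanglement

/-- A normal `2 × 2` matrix becomes, up to a phase, skew-Hermitian plus a scalar. -/
theorem exists_phase_of_normal {G : Matrix (Fin 2) (Fin 2) ℂ}
    (hG : G * G.conjTranspose = G.conjTranspose * G) :
    ∃ z : ℂ, ‖z‖ = 1 ∧ ∃ t : ℝ,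
      z • G + (z • G).conjTranspose = (t : ℂ) • (1 : Matrix (Fin 2) (Fin 2) ℂ) := by
  have h00 := congrFun (congrFun hG 0) 0
  have h01 := congrFun (congrFun hG 0) 1
  simp only [Matrix.mul_apply, Fin.sum_univ_two, Matrix.conjTranspose_apply, RCLike.star_def]
    at h00 h01
  have hyw : ‖G 0 1‖ = ‖G 1 0‖ := by
    have h : ((‖G 0 1‖ ^ 2 : ℝ) : ℂ) = ((‖G 1 0‖ ^ 2 : ℝ) : ℂ) := by
      push_cast
      rw [← Complex.mul_conj', ← Complex.mul_conj']
      linear_combination h00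
    have h' := Complex.ofReal_injective h
    nlinarith [norm_nonneg (G 0 1), norm_nonneg (G 1 0)]
  -- The Hermitian part of `z G` is scalar when its diagonal entries agree and its off-diagonal ones
  -- vanish.
  suffices h : ∃ z : ℂ, ‖z‖ = 1 ∧ z * (G 0 0 - G 1 1) + star (z * (G 0 0 - G 1 1)) = 0 ∧
      z * G 0 1 + star (z * G 1 0) = 0 by
    obtain ⟨z, hz, hd, ho⟩ := h
    refine ⟨z, hz, 2 * (z * G 0 0).re, ?_⟩
    have h0 : z * G 0 0 + star (z * G 0 0) = ((2 * (z * G 0 0).re : ℝ) : ℂ) :=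
      Complex.add_conj _
    have ho' := congrArg star ho
    simp only [star_add, star_star, star_mul', star_sub, star_zero] at hd h0 ho ho'
    ext i j
    fin_cases i <;> fin_cases j <;>
      simp only [Matrix.add_apply, Matrix.smul_apply, Matrix.conjTranspose_apply, Fin.zero_eta,
        Fin.mk_one, smul_eq_mul, star_mul', Matrix.one_apply_eq, mul_one, ne_eq, zero_ne_one,
        one_ne_zero, not_false_eq_true, Matrix.one_apply_ne, mul_zero]
    · exact h0
    · exact ho
    · linear_combination ho'
    · linear_combination h0 - hd
  by_cases hx : G 0 0 - G 1 1 = 0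
  · by_cases hy : G 0 1 = 0
    · have hw : G 1 0 = 0 := by
        rw [← norm_eq_zero, ← hyw, hy, norm_zero]
      exact ⟨1, by simp, by simp [hx], by simp [hy, hw]⟩
    -- With equal diagonal entries only the off-diagonal condition is left. It fixes `z²`, which has
    -- modulus 1 by `hyw`.
    · obtain ⟨z, hz⟩ := IsAlgClosed.exists_pow_nat_eq (-(star (G 1 0)) / G 0 1) two_pos
      have hz1 : ‖z‖ = 1 := by
        have h := congrArg norm hz
        rw [norm_pow, norm_div, norm_neg, norm_star, hyw, div_self (by
          rw [← hyw]; exact norm_ne_zero_iff.2 hy)] at h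
        exact (pow_eq_one_iff_of_nonneg (norm_nonneg z) two_ne_zero).1 h
      refine ⟨z, hz1, by simp [hx], ?_⟩
      have hzz : star z * z = 1 := by
        rw [RCLike.star_def, Complex.conj_mul', hz1]; simp
      rw [eq_div_iff hy] at hz
      rw [star_mul']
      linear_combination star z * hz - z * G 0 1 * hzz
  · set x := G 0 0 - G 1 1 with hxd
    have hn : (‖x‖ : ℂ) ≠ 0 := by exact_mod_cast norm_ne_zero_iff.2 hx
    -- This phase makes `z x = i‖x‖` imaginary; the off-diagonal condition is then the off-diagonal
    -- entry of normality.
    refine ⟨Complex.I * star x / ‖x‖, ?_, ?_, ?_⟩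
    · rw [norm_div, norm_mul, Complex.norm_I, norm_star, one_mul, Complex.norm_real, norm_norm,
        div_self (norm_ne_zero_iff.2 hx)]
    · simp only [star_mul', star_div₀, RCLike.star_def, Complex.conj_I,
        Complex.conj_ofReal, Complex.conj_conj]
      field_simp
      ring
    · have hc : x * star (G 1 0) = star x * G 0 1 := by
        simp only [hxd, star_sub, RCLike.star_def]
        linear_combination h01
      simp only [star_mul', star_div₀, RCLike.star_def, Complex.conj_I, Complex.conj_ofReal,
        Complex.conj_conj] at hc ⊢
      field_simp
      linear_combination -Complex.I * hc

/-- Eliminating `N†N` turns the left side into `cX - X²` with `X = MM†`. This expression is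
invariant under `X ↦ c - X = NN†`, and eliminating `M†M` on the right side gives the same. -/
theorem normal_mul_conjTranspose {n : Type*} [Fintype n] [DecidableEq n] {M N : Matrix n n ℂ}
    {c : ℂ} (h1 : M * M.conjTranspose + N * N.conjTranspose = c • (1 : Matrix n n ℂ))
    (h2 : M.conjTranspose * M + N.conjTranspose * N = c • (1 : Matrix n n ℂ)) :
    M * N.conjTranspose * (M * N.conjTranspose).conjTranspose
      = (M * N.conjTranspose).conjTranspose * (M * N.conjTranspose) := by
  have e1 : N.conjTranspose * N = c • 1 - M.conjTranspose * M := by rw [← h2]; abel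
  have e2 : M.conjTranspose * M = c • 1 - N.conjTranspose * N := by rw [← h2]; abel
  have e3 : N * N.conjTranspose = c • 1 - M * M.conjTranspose := by rw [← h1]; abel
  rw [Matrix.conjTranspose_mul, Matrix.conjTranspose_conjTranspose]
  calc M * N.conjTranspose * (N * M.conjTranspose)
      = M * (N.conjTranspose * N) * M.conjTranspose := by simp only [Matrix.mul_assoc]
    _ = c • (M * M.conjTranspose) - M * M.conjTranspose * (M * M.conjTranspose) := by
        rw [e1, Matrix.mul_sub, Matrix.sub_mul]
        simp only [Matrix.mul_smul, Matrix.smul_mul, Matrix.mul_one, Matrix.mul_assoc]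
    _ = c • (N * N.conjTranspose) - N * N.conjTranspose * (N * N.conjTranspose) := by
        rw [e3]
        simp only [Matrix.mul_sub, Matrix.sub_mul, Matrix.smul_mul, Matrix.mul_smul,
          Matrix.one_mul, Matrix.mul_one, smul_sub]
        abel
    _ = N * (M.conjTranspose * M) * N.conjTranspose := by
        rw [e2, Matrix.mul_sub, Matrix.sub_mul]
        simp only [Matrix.mul_smul, Matrix.smul_mul, Matrix.mul_one, Matrix.mul_assoc]
    _ = N * M.conjTranspose * (M * N.conjTranspose) := by simp only [Matrix.mul_assoc]

/-- If `ψ^R` and `ψ^B` are both maximally mixed, merging needs no entanglement. -/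
theorem mergeable_one_of_reducedB_eq {ψ : EuclideanSpace ℂ (Fin 2 × Fin 2 × Fin 2)}
    (hR : reducedR ψ = (1 / 2 : ℂ) • (1 : Matrix (Fin 2) (Fin 2) ℂ))
    (hB : reducedB ψ = (1 / 2 : ℂ) • (1 : Matrix (Fin 2) (Fin 2) ℂ)) :
    NonCatalyticMergeable ψ 1 := by
  set M : Fin 2 → Matrix (Fin 2) (Fin 2) ℂ := fun a => Matrix.of fun r b => ψ (r, a, b) with hMd
  have h1 : M 0 * (M 0).conjTranspose + M 1 * (M 1).conjTranspose
      = (1 / 2 : ℂ) • (1 : Matrix (Fin 2) (Fin 2) ℂ) := by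
    rw [← hR]
    ext r r'
    simp [hMd, Matrix.mul_apply, reducedR, pureState, Matrix.vecMulVec_apply]
  have h2 : (M 0).conjTranspose * M 0 + (M 1).conjTranspose * M 1
      = (1 / 2 : ℂ) • (1 : Matrix (Fin 2) (Fin 2) ℂ) := by
    have := congrArg Matrix.transpose hB
    rw [Matrix.transpose_smul, Matrix.transpose_one] at this
    rw [← this]
    ext b b'
    simp [hMd, Matrix.mul_apply, reducedB, pureState, Matrix.vecMulVec_apply]
    ring
  obtain ⟨z, hz, t, ht⟩ := exists_phase_of_normal (normal_mul_conjTranspose h1 h2)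
  have hzz : star z * z = 1 := by
    rw [RCLike.star_def, Complex.conj_mul', hz]; simp
  have hs2 := ofReal_one_div_sqrt_mul_self (x := 2) (by norm_num)
  have hR' : reducedR ψ = ((1 / 2 : ℝ) : ℂ) • (1 : Matrix (Fin 2) (Fin 2) ℂ) := by
    rw [hR]; norm_num
  -- The sender measures with `(z⟨0| ± ⟨1|)/√2`. The cross terms of `N k (N k)†` are `±` the
  -- Hermitian part of `z M₀M₁†` doubled, which is the scalar `t`.
  set σ : Fin 2 → ℝ := ![1, -1] with hσ
  set α : Fin 2 → Fin 2 × Fin 1 → ℂ := fun k x =>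
    ((1 / √2 : ℝ) : ℂ) * (if x.1 = 0 then z else (σ k : ℂ)) with hα
  set N : Fin 2 → Matrix (Fin 2) (Fin 2) ℂ := fun k => z • M 0 + (σ k : ℂ) • M 1 with hNd
  have hNN : ∀ k, N k * (N k).conjTranspose
      = ((1 / 2 + σ k * t : ℝ) : ℂ) • (1 : Matrix (Fin 2) (Fin 2) ℂ) := by
    intro k
    have hσ2 : (σ k : ℂ) * σ k = 1 := by
      fin_cases k <;> simp [hσ]
    have e : N k * (N k).conjTranspose
        = (M 0 * (M 0).conjTranspose + M 1 * (M 1).conjTranspose) + (σ k : ℂ) •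
          (z • (M 0 * (M 1).conjTranspose) + (z • (M 0 * (M 1).conjTranspose)).conjTranspose) := by
      simp only [hNd, Matrix.conjTranspose_add, Matrix.conjTranspose_smul, Matrix.add_mul,
        Matrix.mul_add, Matrix.smul_mul, Matrix.mul_smul, smul_smul, Matrix.conjTranspose_mul,
        Matrix.conjTranspose_conjTranspose, smul_add]
      rw [hzz, RCLike.star_def, Complex.conj_ofReal, hσ2, one_smul, one_smul, mul_comm (starRingEnd ℂ z)]
      abel
    rw [e, h1, ht, smul_smul, ← add_smul]
    push_cast
    rfl
  -- The scalar is the squared norm of a row of `N k`.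
  have hp : ∀ k, 0 ≤ 1 / 2 + σ k * t := by
    intro k
    have h := congrFun (congrFun (hNN k) 0) 0
    simp only [Matrix.mul_apply, Matrix.conjTranspose_apply, RCLike.star_def, Complex.mul_conj',
      Matrix.smul_apply, Matrix.one_apply_eq, smul_eq_mul, mul_one] at h
    have h' : ∑ x, ‖N k 0 x‖ ^ 2 = 1 / 2 + σ k * t := by exact_mod_cast h
    rw [← h']
    positivity
  refine nonCatalyticMergeable_of_rank_one le_rfl (by norm_num) hR' (α := α)
    (p := fun k => 1 / 2 * (1 / 2 + σ k * t)) ?_ (fun k => mul_nonneg (by norm_num) (hp k)) ?_ ?_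
  · rintro ⟨a, l⟩ ⟨a', l'⟩
    have hterm : ∀ A B : ℂ, star (((1 / √2 : ℝ) : ℂ) * A) *
        (((1 / √2 : ℝ) : ℂ) * B) = ((1 / 2 : ℝ) : ℂ) * (star A * B) := by
      intro A B
      rw [← hs2, star_mul', RCLike.star_def, Complex.conj_ofReal]
      ring
    rw [Subsingleton.elim l l']
    simp only [hα, hterm, Fin.sum_univ_two, ← mul_add]
    fin_cases a <;> fin_cases a' <;> simp only [Fin.zero_eta, Fin.mk_one, if_true, hσ,
      Prod.mk.injEq, and_true, zero_ne_one, one_ne_zero, if_false, hzz] <;> norm_num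
  · simp [hσ, Fin.sum_univ_two]
    ring
  · intro k r r'
    have hentry : ∀ r (y : Fin 2 × Fin 1), ∑ x, α k x * mergingInput ψ 1 (r, x, y)
        = ((1 / √2 : ℝ) : ℂ) * N k r y.1 := by
      intro r y
      simp [hα, hNd, hMd, mergingInput, maxEntangled, Fintype.sum_prod_type,
        Subsingleton.elim y.2 0]
      ring
    simp only [hentry, Fintype.sum_prod_type, Finset.univ_unique, Finset.sum_singleton]
    have h := congrFun (congrFun (hNN k) r') r
    simp only [Matrix.mul_apply, Matrix.conjTranspose_apply, Matrix.smul_apply, Matrix.one_apply,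
      smul_eq_mul, mul_ite, mul_one, mul_zero] at h
    calc _ = ((1 / 2 : ℝ) : ℂ) * ∑ b, N k r' b * star (N k r b) := by
          rw [Finset.mul_sum, ← hs2]
          refine Finset.sum_congr rfl fun b _ => ?_
          rw [star_mul', RCLike.star_def, Complex.conj_ofReal]
          ring
      _ = _ := by
          rw [h, mul_ite, mul_zero, ← Complex.ofReal_mul]
          simp only [eq_comm]

end WithoutEntanglement

/-! ### The value of `⌈2λ₀⌉` -/

section LargestEigenvalue

variable {A : Type*} [Fintype A]

theorem hasEigenvalue_eigenvalues {n : Type*} [Fintype n] [DecidableEq n] {ρ : Matrix n n ℂ}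
    (h : ρ.IsHermitian) (i : n) :
    Module.End.HasEigenvalue (Matrix.toLin' ρ) (h.eigenvalues i : ℂ) := by
  refine Module.End.hasEigenvalue_of_hasEigenvector (x := (h.eigenvectorBasis i).ofLp)
    ⟨Module.End.mem_eigenspace_iff.2 ?_, ?_⟩
  · rw [Matrix.toLin'_apply, h.mulVec_eigenvectorBasis]
    ext
    simp
  · exact (WithLp.ofLp_eq_zero 2).ne.2 (h.eigenvectorBasis.orthonormal.ne_zero i)

theorem exists_eigenvalues_eq {n : Type*} [Fintype n] [DecidableEq n] {ρ : Matrix n n ℂ}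
    (h : ρ.IsHermitian) {x : ℝ} (hx : Module.End.HasEigenvalue (Matrix.toLin' ρ) (x : ℂ)) :
    ∃ i, h.eigenvalues i = x := by
  have h1 := hx.mem_spectrum
  rw [Matrix.spectrum_toLin'] at h1
  have h2 : x ∈ spectrum ℝ ρ := spectrum.of_algebraMap_mem ℂ h1
  rwa [h.spectrum_real_eq_range_eigenvalues] at h2

/-- Twice the largest eigenvalue of a qubit state rounds up to `1` if the state is maximally mixed,
and to `2` otherwise. -/
theorem ceil_largest_eigenvalue {R : Type*} [Fintype R]
    {ψ : EuclideanSpace ℂ (R × A × Fin 2)} (hψ : ‖ψ‖ = 1) {lam : ℝ}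
    (hlam : IsGreatest
      {x : ℝ | Module.End.HasEigenvalue (Matrix.toLin' (reducedB ψ)) (x : ℂ)} lam) :
    (⌈lam * 2⌉ = 1 ∧ reducedB ψ = (1 / 2 : ℂ) • (1 : Matrix (Fin 2) (Fin 2) ℂ)) ∨
    (⌈lam * 2⌉ = 2 ∧ reducedB ψ ≠ (1 / 2 : ℂ) • (1 : Matrix (Fin 2) (Fin 2) ℂ)) := by
  have h := isHermitian_reducedB ψ
  have htr : h.eigenvalues 0 + h.eigenvalues 1 = 1 := by
    have h1 := trace_reducedB ψ
    rw [h.trace_eq_sum_eigenvalues, hψ, Fin.sum_univ_two] at h1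
    norm_num at h1
    exact_mod_cast h1
  have hnn : ∀ i, 0 ≤ h.eigenvalues i := fun i => by
    rw [← eigenvalues_reducedB_eq]
    positivity
  have hle : ∀ i, h.eigenvalues i ≤ lam := fun i => hlam.2 (hasEigenvalue_eigenvalues h i)
  have hub : lam ≤ 1 := by
    obtain ⟨i, hi⟩ := exists_eigenvalues_eq h hlam.1
    rw [← hi]
    have h0 := hnn 0
    have h1 := hnn 1
    fin_cases i <;> simp only [Fin.zero_eta, Fin.mk_one] <;> linarith
  by_cases hB : reducedB ψ = (1 / 2 : ℂ) • (1 : Matrix (Fin 2) (Fin 2) ℂ)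
  · refine Or.inl ⟨?_, hB⟩
    obtain ⟨v, hv⟩ := hlam.1.exists_hasEigenvector
    have h1 := hv.apply_eq_smul
    rw [Matrix.toLin'_apply, hB, Matrix.smul_mulVec, Matrix.one_mulVec] at h1
    have h2 : (1 / 2 : ℂ) = lam := smul_left_injective ℂ hv.2 h1
    have h3 : lam = 1 / 2 := by
      apply Complex.ofReal_injective
      rw [← h2]
      norm_num
    rw [h3]
    norm_num
  · refine Or.inr ⟨?_, hB⟩
    -- Otherwise both eigenvalues are at most 1/2 with sum 1, so the state is maximally mixed.
    have hlt : 1 / 2 < lam := by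
      by_contra hcon
      apply hB
      have h0 := hle 0
      have h1 := hle 1
      rw [h.eq_smul_one_of_eigenvalues (c := 1 / 2)
        (Fin.forall_fin_two.2 ⟨by linarith, by linarith⟩)]
      norm_num
    rw [Int.ceil_eq_iff]
    constructor <;> push_cast <;> linarith

end LargestEigenvalue

/-! ### The main theorem -/

theorem mainTheorem6 (ψ : EuclideanSpace ℂ (Fin 2 × Fin 2 × Fin 2)) (hψ : ‖ψ‖ = 1)
    (hR : reducedR ψ = (1 / 2 : ℂ) • (1 : Matrix (Fin 2) (Fin 2) ℂ))
    (lam : ℝ)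
    (hlam : IsGreatest
      {x : ℝ | Module.End.HasEigenvalue (Matrix.toLin' (reducedB ψ)) (x : ℂ)} lam) :
    (∀ K : ℕ, 1 ≤ K →
      (NonCatalyticMergeable ψ K ↔ Real.logb 2 (⌈lam * 2⌉ : ℝ) ≤ Real.logb 2 (K : ℝ))) ∧
    (0 ∈ nonCatalyticCosts ψ ↔
      reducedB ψ = (1 / 2 : ℂ) • (1 : Matrix (Fin 2) (Fin 2) ℂ)) ∧
    (reducedB ψ ≠ (1 / 2 : ℂ) • (1 : Matrix (Fin 2) (Fin 2) ℂ) →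
      IsLeast (nonCatalyticCosts ψ) 1) := by
  have hR' : reducedR ψ = ((1 / 2 : ℝ) : ℂ) • (1 : Matrix (Fin 2) (Fin 2) ℂ) := by
    rw [hR]; norm_num
  have hone : NonCatalyticMergeable ψ 1 ↔
      reducedB ψ = (1 / 2 : ℂ) • (1 : Matrix (Fin 2) (Fin 2) ℂ) :=
    ⟨reducedB_eq_of_mergeable_one hψ hR, mergeable_one_of_reducedB_eq hR⟩
  have htwo : ∀ K, 2 ≤ K → NonCatalyticMergeable ψ K := fun K hK =>
    mergeable_of_two_le (by norm_num) hR' hK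
  have hlog2 : Real.logb 2 ((2 : ℕ) : ℝ) = 1 := by
    rw [Nat.cast_ofNat]
    exact Real.logb_self_eq_one one_lt_two
  have hmono : ∀ m K : ℕ, 1 ≤ m → 1 ≤ K → (Real.logb 2 (m : ℝ) ≤ Real.logb 2 (K : ℝ) ↔ m ≤ K) := by
    intro m K hm hK
    rw [Real.logb_le_logb one_lt_two (by exact_mod_cast hm) (by exact_mod_cast hK), Nat.cast_le]
  refine ⟨fun K hK => ?_, ⟨?_, fun hB => ⟨1, le_rfl, hone.2 hB, by simp⟩⟩, fun hB =>
    ⟨⟨2, one_le_two, htwo 2 le_rfl, hlog2.symm⟩, ?_⟩⟩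
  · rcases ceil_largest_eigenvalue hψ hlam with ⟨hc, hB⟩ | ⟨hc, hB⟩
    · rw [hc]
      have hm := hmono 1 K le_rfl hK
      rw [Nat.cast_one] at hm
      rw [Int.cast_one, hm]
      refine ⟨fun _ => hK, fun _ => ?_⟩
      rcases hK.eq_or_lt with rfl | hK
      · exact hone.2 hB
      · exact htwo K hK
    · rw [hc]
      have hm := hmono 2 K one_le_two hK
      rw [Nat.cast_ofNat] at hm
      rw [Int.cast_ofNat, hm]
      refine ⟨fun hM => ?_, htwo K⟩
      rcases hK.eq_or_lt with rfl | hK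
      · exact absurd (hone.1 hM) hB
      · exact hK
  · rintro ⟨K, hK, hM, h0⟩
    rcases hK.eq_or_lt with rfl | hK
    · exact hone.1 hM
    · have := (hmono 2 K one_le_two (by omega)).2 hK
      rw [hlog2, ← h0] at this
      norm_num at this
  · rintro _ ⟨K, hK, hM, rfl⟩
    rcases hK.eq_or_lt with rfl | hK
    · exact absurd (hone.1 hM) hB
    · rw [← hlog2]
      exact (hmono 2 K one_le_two (by omega)).2 hK
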